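/- Let $\mathcal{E}=\{\eta_i,\rho_i\}_{i=0}^{n-1}$ be a bipartite quantum state ensemble: the $\rho_i$ are density operators on $\mathbb{C}^{d_{\rm A}}\otimes\mathbb{C}^{d_{\rm B}}$, $\eta_i\geqslant 0$, and $\sum_i\eta_i=1$. Let \[ q_{\rm G}(\mathcal{E})=\max_{\{M_i\}}\sum_{i=0}^{n-1}\eta_i\operatorname{Tr}(\rho_i^{\rm PT}M_i), \] where $\rm PT$ is the partial transposition and the maximum is over all measurements $\{M_i\}_{i=0}^{n-1}$ ($M_i\succeq 0$, $\sum_i M_i=\mathbb{1}$). For an ensemble $\{\mu_i,\sigma_i\}_{i=0}^{n-1}$ of states shared by Alice and Bob let $p_{\rm L}(\{\mu_i,\sigma_i\})$ be the supremum of $\sum_i\mu_i\operatorname{Tr}(\sigma_iM_i)$ over the measurements $\{M_i\}_{i=0}^{n-1}$ that can be realized by finitely many rounds of local operations and classical communication (LOCC). For $L\geqslant 1$ and $i\in\{0,\ldots,n-1\}$ let \[ \eta_i^{(L)}=\sum_{\vec c}\ \prod_{l=1}^{L}\eta_{c_l},\qquad \rho_i^{(L)}=\frac{1}{\eta_i^{(L)}}\sum_{\vec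 c}\ \Big(\prod_{l=1}^{L}\eta_{c_l}\Big)\bigotimes_{l=1}^{L}\rho_{c_l}, \] where both sums are over the $\vec c=(c_1,\ldots,c_L)\in\{0,\ldots,n-1\}^L$ with $c_1+\cdots+c_L\equiv i \pmod n$, and where Alice (Bob) holds the first (second) tensor factors of all $L$ copies; if $\eta_i^{(L)}=0$, let $\rho_i^{(L)}$ be an arbitrary state. Then, for every $L\geqslant 1$, \[ p_{\rm L}\big(\{\tfrac1n,\rho_i^{(L)}\}_{i=0}^{n-1}\big)\leqslant\frac1n+\frac{(n-1)(n^2-n+2)}{2n}\,\big[n\,q_{\rm G}(\mathcal{E})-1\big]^{L}. \] If moreover $q_{\rm G}(\mathcal{E})<\frac2n$, then \[ \lim_{L\to\infty}p_{\rm L}\big(\{\tfrac1n,\rho_i^{(L)}\}_{i=0}^{n-1}\big)=\frac1n . \] -/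

import Mathlib

namespace QDH

open Matrix
open scoped ComplexOrder Kronecker

noncomputable section

/-- Operators on the bipartite Hilbert space `ℂ^A ⊗ ℂ^B`, as matrices in the product basis. -/
abbrev Op (A B : Type) : Type := Matrix (A × B) (A × B) ℂ

/-- A bipartite quantum state: a positive-semidefinite operator of unit trace. -/
def IsState {A B : Type} [Fintype A] [Fintype B] (ρ : Op A B) : Prop :=
  ρ.PosSemidef ∧ ρ.trace = 1

/-- A bipartite quantum state ensemble `{η i, ρ i}`: the `ρ i` are states, prepared with
probabilities `η i`. -/
def IsEnsemble {n : ℕ} {A B : Type} [Fintype A] [Fintype B]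
    (η : Fin n → ℝ) (ρ : Fin n → Op A B) : Prop :=
  (∀ i, 0 ≤ η i) ∧ ∑ i, η i = 1 ∧ ∀ i, IsState (ρ i)

/-- A measurement (POVM) with `n` outcomes. -/
def IsMeasurement {n : ℕ} {A B : Type} [Fintype A] [Fintype B] [DecidableEq A] [DecidableEq B]
    (M : Fin n → Op A B) : Prop :=
  (∀ i, (M i).PosSemidef) ∧ ∑ i, M i = 1

/-- The measurements with `n` outcomes that can be realized by local operations and classical
communication, described by recursion on the first step of the protocol.
* `guess`: both parties stop and output `j`, so the effect of the outcome `j` is the identity.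
* `alice`: Alice applies an arbitrary local quantum instrument, with Kraus operators
  `K k : ℂ^A → ℂ^A'` (the dimension of her system may change, so that she may add and discard
  local ancillas), and announces `k`. Depending on `k`, the parties go on with an LOCC
  measurement `M k` of the system they are left with. The outcome `i` of the whole procedure then
  has the effect `∑ k, (K k ⊗ 1)† (M k i) (K k ⊗ 1)`.
* `bob`: the same with the roles exchanged.
Local and shared randomness are the case of Kraus operators proportional to the identity. An
instrument that has several Kraus operators for one announced outcome is covered because `M k` need
not depend on all of `k`. -/
inductive IsLOCC {n : ℕ} : ∀ {A B : Type} [Fintype A] [Fintype B] [DecidableEq A] [DecidableEq B],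
    (Fin n → Op A B) → Prop
  | guess {A B : Type} [Fintype A] [Fintype B] [DecidableEq A] [DecidableEq B] (j : Fin n) :
      IsLOCC (fun i => if i = j then (1 : Op A B) else 0)
  | alice {A A' B κ : Type} [Fintype A] [Fintype A'] [Fintype B] [Fintype κ]
      [DecidableEq A] [DecidableEq A'] [DecidableEq B]
      (K : κ → Matrix A' A ℂ) (hK : ∑ k, (K k)ᴴ * K k = 1)
      (M : κ → Fin n → Op A' B) (hM : ∀ k, IsLOCC (M k)) :
      IsLOCC (fun i => ∑ k, (K k ⊗ₖ (1 : Matrix B B ℂ))ᴴ * M k i * (K k ⊗ₖ (1 : Matrix B B ℂ)))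
  | bob {A B B' κ : Type} [Fintype A] [Fintype B] [Fintype B'] [Fintype κ]
      [DecidableEq A] [DecidableEq B] [DecidableEq B']
      (K : κ → Matrix B' B ℂ) (hK : ∑ k, (K k)ᴴ * K k = 1)
      (M : κ → Fin n → Op A B') (hM : ∀ k, IsLOCC (M k)) :
      IsLOCC (fun i => ∑ k, ((1 : Matrix A A ℂ) ⊗ₖ K k)ᴴ * M k i * ((1 : Matrix A A ℂ) ⊗ₖ K k))

/-- The partial transposition (on the second party, in the standard basis). -/
def partialTranspose {A B : Type} (E : Op A B) : Op A B :=
  Matrix.of fun x y => E (x.1, y.2) (y.1, x.2)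

/-- The average `∑ i, η i Tr (ρ i M i)`; the traces are real for Hermitian `ρ i` and `M i`. -/
def avgSuccess {n : ℕ} {A B : Type} [Fintype A] [Fintype B]
    (η : Fin n → ℝ) (ρ M : Fin n → Op A B) : ℝ :=
  ∑ i, η i * (ρ i * M i).trace.re

/-- `p_L`: the optimal success probability of the discrimination of `{η i, ρ i}` by LOCC
measurements. -/
def pL {n : ℕ} {A B : Type} [Fintype A] [Fintype B] [DecidableEq A] [DecidableEq B]
    (η : Fin n → ℝ) (ρ : Fin n → Op A B) : ℝ :=
  sSup {r | ∃ M : Fin n → Op A B, IsLOCC M ∧ r = avgSuccess η ρ M}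

/-- `q_G`: the optimal value of `∑ i, η i Tr (ρ i^PT M i)` over all measurements. -/
def qG {n : ℕ} {A B : Type} [Fintype A] [Fintype B] [DecidableEq A] [DecidableEq B]
    (η : Fin n → ℝ) (ρ : Fin n → Op A B) : ℝ :=
  sSup {r | ∃ M : Fin n → Op A B,
    IsMeasurement M ∧ r = avgSuccess η (fun i => partialTranspose (ρ i)) M}

/-- The vectors `c ∈ ℤ_n^L` whose entries have the sum `i` modulo `n`. -/
def sumClass {n : ℕ} (L : ℕ) (i : Fin n) : Finset (Fin L → Fin n) :=
  Finset.univ.filter fun c => (∑ l, (c l : ℕ)) % n = (i : ℕ)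

/-- `ρ_c = ρ_{c_1} ⊗ ⋯ ⊗ ρ_{c_L}`, an operator on `(ℂ^A)^{⊗L} ⊗ (ℂ^B)^{⊗L}`: Alice holds the `L`
first subsystems and Bob holds the `L` second ones. -/
def tensorState {n : ℕ} {A B : Type} (ρ : Fin n → Op A B) {L : ℕ} (c : Fin L → Fin n) :
    Op (Fin L → A) (Fin L → B) :=
  Matrix.of fun x y => ∏ l, ρ (c l) (x.1 l, x.2 l) (y.1 l, y.2 l)

/-- `η_i^(L)`, the sum of the `η_c = η_{c_1} ⋯ η_{c_L}` over the class of `i`. -/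
def foldProb {n : ℕ} (η : Fin n → ℝ) (L : ℕ) (i : Fin n) : ℝ :=
  ∑ c ∈ sumClass L i, ∏ l, η (c l)

/-- `ρ_i^(L) = (1 / η_i^(L)) ∑ η_c ρ_c`, the sum over the class of `i`. If `η_i^(L) = 0`, where this
formula has no meaning, the value is taken from a given family `τ`. -/
def foldState {n : ℕ} {A B : Type} (η : Fin n → ℝ) (ρ : Fin n → Op A B) (L : ℕ)
    (τ : Fin n → Op (Fin L → A) (Fin L → B)) (i : Fin n) : Op (Fin L → A) (Fin L → B) :=
  if foldProb η L i = 0 then τ i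
  else ((1 / foldProb η L i : ℝ) : ℂ) •
    ∑ c ∈ sumClass L i, ((∏ l, η (c l) : ℝ) : ℂ) • tensorState ρ c

end

end QDH

open QDH

/-! Put `ε = n * qG η ρ - 1`, let `ζ` be a primitive `n`-th root of unity and let `X_k = ∑ i, ζ^(k
i) η_i ρ_i^PT` be the Fourier transform of the partially transposed ensemble. Phases multiply along
tensor factors, so the fold over the classes of `c_1 + ⋯ + c_L` is a cyclic convolution: `η_i^(L)
(ρ_i^(L))^PT` is the inverse transform of `X_k^{⊗L}` (`foldProb_smul_partialTranspose_foldState`).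

For `k ≠ 0` the nuclear norm of `X_k` is at most `ε`. Indeed a contraction `C` with `Tr (X_k C) =
‖X_k‖₁` yields the measurement `(1 + Re (ζ^(k i) C)) / n`, whose value `(1 + ‖X_k‖₁) / n` is at most
`qG` (`nuclearLE_sum_smul_partialTranspose`). Hence `‖X_k^{⊗L}‖₁ ≤ ε^L`.

The effects of an LOCC measurement remain a measurement after partial transposition
(`isMeasurement_and_ppt_of_isLOCC`). Paired with them, the term `k = 0` contributes exactly `1/n`
and each of the other `n - 1` terms at most `ε^L / n`. This bounds the success probability for the
priors `η_i^(L)` (`sum_foldProb_mul_le`). Traces of the same formula show that these priors are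
nearly uniform (`abs_foldProb_sub_le`), which gives the bound for uniform priors. Constant guessing
achieves `1/n`, and `qG < 2/n` means `ε < 1`, so the limit follows by squeezing. -/

section

open Matrix
open scoped ComplexOrder Kronecker

/-- An upper bound `δ` on the nuclear norm of `X`, witnessed by a decomposition into rank-one
matrices. -/
def NuclearLE {ι : Type} (X : Matrix ι ι ℂ) [Fintype ι] (δ : ℝ) : Prop :=
  ∃ (J : Type) (_ : Fintype J) (u v : J → EuclideanSpace ℂ ι),
    X = ∑ j, vecMulVec (u j).ofLp (star (v j).ofLp) ∧ ∑ j, ‖u j‖ * ‖v j‖ ≤ δ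

/-! ### Nuclear norm and its duality with contractions -/

section Nuclear

variable {ι : Type} [Fintype ι]

theorem NuclearLE.nonneg {X : Matrix ι ι ℂ} {δ : ℝ} (h : NuclearLE X δ) : 0 ≤ δ := by
  obtain ⟨J, _, u, v, -, hδ⟩ := h
  exact le_trans (Finset.sum_nonneg fun j _ => by positivity) hδ

theorem NuclearLE.mono {X : Matrix ι ι ℂ} {δ ε : ℝ} (h : NuclearLE X δ) (hδ : δ ≤ ε) :
    NuclearLE X ε := by
  obtain ⟨J, _, u, v, hX, h⟩ := h
  exact ⟨J, _, u, v, hX, h.trans hδ⟩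

theorem trace_vecMulVec_mul (u v : ι → ℂ) (C : Matrix ι ι ℂ) :
    (vecMulVec u v * C).trace = v ⬝ᵥ (C *ᵥ u) := by
  rw [vecMulVec_mul, trace_vecMulVec, dotProduct_comm, dotProduct_mulVec]

/-- A rank-one term `u v†` pairs with `C` to `v† C u`, so bounding the sesquilinear form of `C`
suffices and no operator norm is needed. -/
theorem NuclearLE.norm_trace_mul_le {X C : Matrix ι ι ℂ} {δ : ℝ} (h : NuclearLE X δ)
    (hC : ∀ u v : EuclideanSpace ℂ ι, ‖star v.ofLp ⬝ᵥ (C *ᵥ u.ofLp)‖ ≤ ‖v‖ * ‖u‖) :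
    ‖(X * C).trace‖ ≤ δ := by
  obtain ⟨J, _, u, v, rfl, hδ⟩ := h
  rw [Finset.sum_mul, trace_sum]
  refine (norm_sum_le _ _).trans (le_trans (Finset.sum_le_sum fun j _ => ?_) hδ)
  rw [trace_vecMulVec_mul, mul_comm]
  exact hC _ _

theorem exists_nuclearLE [DecidableEq ι] (X : Matrix ι ι ℂ) : ∃ δ, NuclearLE X δ := by
  refine ⟨_, ι, inferInstance, fun j => WithLp.toLp 2 (X.col j),
    fun j => WithLp.toLp 2 (Pi.single j 1), ?_, le_rfl⟩
  ext x y
  simp [Matrix.sum_apply, vecMulVec_apply, Pi.single_apply]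

theorem Matrix.PosSemidef.exists_conjTranspose_mul_self [DecidableEq ι] {M : Matrix ι ι ℂ}
    (hM : M.PosSemidef) : ∃ B : Matrix ι ι ℂ, M = Bᴴ * B := by
  open scoped MatrixOrder in
  exact CStarAlgebra.nonneg_iff_eq_star_mul_self.mp hM.nonneg

theorem star_dotProduct_conjTranspose_mul_mulVec (B : Matrix ι ι ℂ) (u v : ι → ℂ) :
    star v ⬝ᵥ ((Bᴴ * B) *ᵥ u) =
      inner ℂ (WithLp.toLp 2 (B *ᵥ v)) (WithLp.toLp 2 (B *ᵥ u)) := by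
  rw [EuclideanSpace.inner_eq_star_dotProduct, ← mulVec_mulVec, dotProduct_mulVec,
    ← star_mulVec, dotProduct_comm]

theorem star_dotProduct_self (v : EuclideanSpace ℂ ι) :
    star v.ofLp ⬝ᵥ v.ofLp = ((‖v‖ ^ 2 : ℝ) : ℂ) := by
  rw [dotProduct_comm, ← EuclideanSpace.inner_eq_star_dotProduct, inner_self_eq_norm_sq_to_K]
  simp

/-- A combination of the effects of a measurement with coefficients in the unit disc is a
contraction. -/
theorem norm_dotProduct_sum_smul_mulVec_le [DecidableEq ι] {n : ℕ} {N : Fin n → Matrix ι ι ℂ}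
    (hN : ∀ i, (N i).PosSemidef) (hsum : ∑ i, N i = 1) {c : Fin n → ℂ} (hc : ∀ i, ‖c i‖ ≤ 1)
    (u v : EuclideanSpace ℂ ι) :
    ‖star v.ofLp ⬝ᵥ ((∑ i, c i • N i) *ᵥ u.ofLp)‖ ≤ ‖v‖ * ‖u‖ := by
  -- With `N i = (B i)ᴴ * B i`, completeness reads `∑ ‖B i w‖² = ‖w‖²`, and Cauchy–Schwarz over `i`
  -- finishes.
  choose B hB using fun i => (hN i).exists_conjTranspose_mul_self
  have key : ∀ w : EuclideanSpace ℂ ι,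
      ∑ i, ‖WithLp.toLp 2 (B i *ᵥ w.ofLp)‖ ^ 2 = ‖w‖ ^ 2 := by
    intro w
    have h1 : star w.ofLp ⬝ᵥ ((∑ i, N i) *ᵥ w.ofLp) = ((‖w‖ ^ 2 : ℝ) : ℂ) := by
      rw [hsum, one_mulVec, star_dotProduct_self]
    rw [sum_mulVec, dotProduct_sum] at h1
    have h2 : ∀ i, star w.ofLp ⬝ᵥ (N i *ᵥ w.ofLp) =
        ((‖WithLp.toLp 2 (B i *ᵥ w.ofLp)‖ ^ 2 : ℝ) : ℂ) := by
      intro i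
      rw [hB i, star_dotProduct_conjTranspose_mul_mulVec, inner_self_eq_norm_sq_to_K]
      simp
    simp_rw [h2] at h1
    exact_mod_cast h1
  rw [sum_mulVec, dotProduct_sum]
  calc _ ≤ ∑ i, ‖star v.ofLp ⬝ᵥ ((c i • N i) *ᵥ u.ofLp)‖ := norm_sum_le _ _
    _ ≤ ∑ i, ‖WithLp.toLp 2 (B i *ᵥ v.ofLp)‖ * ‖WithLp.toLp 2 (B i *ᵥ u.ofLp)‖ := by
      refine Finset.sum_le_sum fun i _ => ?_
      rw [smul_mulVec, dotProduct_smul, norm_smul, hB i, star_dotProduct_conjTranspose_mul_mulVec]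
      calc _ ≤ 1 * ‖(inner ℂ (WithLp.toLp 2 (B i *ᵥ v.ofLp)) (WithLp.toLp 2 (B i *ᵥ u.ofLp)) : ℂ)‖ :=
            mul_le_mul_of_nonneg_right (hc i) (norm_nonneg _)
        _ ≤ _ := by rw [one_mul]; exact norm_inner_le_norm _ _
    _ ≤ √(∑ i, ‖WithLp.toLp 2 (B i *ᵥ v.ofLp)‖ ^ 2) * √(∑ i, ‖WithLp.toLp 2 (B i *ᵥ u.ofLp)‖ ^ 2) :=
      Real.sum_mul_le_sqrt_mul_sqrt _ _ _
    _ = ‖v‖ * ‖u‖ := by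
      rw [key, key, Real.sqrt_sq (norm_nonneg _), Real.sqrt_sq (norm_nonneg _)]

/-- A singular-value decomposition: `C` is a contraction, in the sense of its sesquilinear form,
whose pairing with `X` attains the nuclear norm of `X`. -/
theorem exists_nuclearLE_trace_mul [DecidableEq ι] (X : Matrix ι ι ℂ) :
    ∃ C : Matrix ι ι ℂ, (∀ v : EuclideanSpace ℂ ι, ‖star v.ofLp ⬝ᵥ (C *ᵥ v.ofLp)‖ ≤ ‖v‖ ^ 2) ∧
      NuclearLE X (X * C).trace.re := by
  have hA : (Xᴴ * X).IsHermitian := isHermitian_conjTranspose_mul_self X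
  set b := hA.eigenvectorBasis with hb
  let u : ι → EuclideanSpace ℂ ι := fun j => WithLp.toLp 2 (X *ᵥ (b j).ofLp)
  -- The left singular vectors. Where `u j = 0` the inverse norm is `0` by convention, so `w j = 0`.
  let w : ι → EuclideanSpace ℂ ι := fun j => ((‖u j‖⁻¹ : ℝ) : ℂ) • u j
  have huu : ∀ i j, i ≠ j → inner ℂ (u i) (u j) = (0 : ℂ) := by
    intro i j hij
    have h : inner ℂ (b i) (b j) = (0 : ℂ) := b.orthonormal.2 hij
    rw [EuclideanSpace.inner_eq_star_dotProduct, dotProduct_comm] at h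
    simp only [u]
    rw [← star_dotProduct_conjTranspose_mul_mulVec, hA.mulVec_eigenvectorBasis, dotProduct_smul, h,
      smul_zero]
  have hwu : ∀ i j, inner ℂ (w i) (u j) = if i = j then ((‖u j‖ : ℝ) : ℂ) else 0 := by
    intro i j
    simp only [w, inner_smul_left]
    split_ifs with h
    · subst h
      rw [inner_self_eq_norm_sq_to_K]
      by_cases h0 : ‖u i‖ = 0
      · simp [h0]
      · have : ((‖u i‖ : ℝ) : ℂ) ≠ 0 := by exact_mod_cast h0
        simp
        field_simp
    · rw [huu i j h, mul_zero]
  have hX : X = ∑ j, vecMulVec (u j).ofLp (star (b j).ofLp) := by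
    have h1 : ∑ j, vecMulVec (b j).ofLp (star (b j).ofLp) = (1 : Matrix ι ι ℂ) := by
      ext x y
      have := b.sum_inner_mul_inner (EuclideanSpace.single x 1) (EuclideanSpace.single y 1)
      simp [EuclideanSpace.inner_single_left, EuclideanSpace.inner_single_right] at this
      simp [Matrix.sum_apply, vecMulVec_apply, this, one_apply, eq_comm]
    calc X = X * ∑ j, vecMulVec (b j).ofLp (star (b j).ofLp) := by rw [h1, mul_one]
      _ = _ := by simp only [Finset.mul_sum, mul_vecMulVec, u]
  have bessel : ∀ v : EuclideanSpace ℂ ι, ∑ j, ‖(inner ℂ (w j) v : ℂ)‖ ^ 2 ≤ ‖v‖ ^ 2 := by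
    intro v
    -- Only the nonzero `w j` are orthonormal; the others add nothing to the Bessel sum.
    have hon : Orthonormal ℂ (fun j : {j // ‖u j‖ ≠ 0} => w j) := by
      refine ⟨fun j => ?_, fun i j hij => ?_⟩
      · simp only [w, norm_smul]
        simp [j.2]
      · have h : (i : ι) ≠ j := fun h => hij (Subtype.ext h)
        simp only [w, inner_smul_left, inner_smul_right, huu _ _ h, mul_zero]
    have h := hon.sum_inner_products_le v (s := Finset.univ)
    refine le_trans (le_of_eq ?_) h
    rw [← Finset.sum_filter_of_ne (p := fun j => ‖u j‖ ≠ 0),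
      Finset.sum_subtype _ (p := fun j => ‖u j‖ ≠ 0) (by simp)]
    intro j _ hj h0
    simp [w, h0] at hj
  -- Since `X = ∑ u_j b_j†`, the choice `C = ∑ b_j w_j†` gives `Tr (X C) = ∑ ⟨w_j, u_j⟩ = ∑ ‖u_j‖`.
  refine ⟨∑ j, vecMulVec (b j).ofLp (star (w j).ofLp), fun v => ?_, ι, inferInstance, u, b, hX, ?_⟩
  · rw [sum_mulVec, dotProduct_sum]
    have hterm : ∀ j, star v.ofLp ⬝ᵥ (vecMulVec (b j).ofLp (star (w j).ofLp) *ᵥ v.ofLp) =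
        inner ℂ (w j) v * inner ℂ v (b j) := by
      intro j
      rw [vecMulVec_mulVec, EuclideanSpace.inner_eq_star_dotProduct,
        EuclideanSpace.inner_eq_star_dotProduct, dotProduct_comm v.ofLp, dotProduct_comm _ (star v.ofLp)]
      simp [mul_comm]
    simp_rw [hterm]
    calc _ ≤ ∑ j, ‖(inner ℂ (w j) v : ℂ)‖ * ‖(inner ℂ v (b j) : ℂ)‖ := by
          refine (norm_sum_le _ _).trans (le_of_eq ?_)
          simp
      _ ≤ √(∑ j, ‖(inner ℂ (w j) v : ℂ)‖ ^ 2) * √(∑ j, ‖(inner ℂ v (b j) : ℂ)‖ ^ 2) :=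
        Real.sum_mul_le_sqrt_mul_sqrt _ _ _
      _ ≤ ‖v‖ * ‖v‖ := by
        refine mul_le_mul ?_ ?_ (Real.sqrt_nonneg _) (norm_nonneg _)
        · exact (Real.sqrt_le_sqrt (bessel v)).trans (Real.sqrt_sq (norm_nonneg _)).le
        · rw [b.sum_sq_norm_inner_left]
          exact (Real.sqrt_sq (norm_nonneg _)).le
      _ = ‖v‖ ^ 2 := by ring
  · have htr : (X * ∑ j, vecMulVec (b j).ofLp (star (w j).ofLp)).trace = ∑ j, ((‖u j‖ : ℝ) : ℂ) := by
      rw [Finset.mul_sum, trace_sum]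
      refine Finset.sum_congr rfl fun j _ => ?_
      rw [mul_vecMulVec, trace_vecMulVec]
      have := hwu j j
      rw [if_pos rfl, EuclideanSpace.inner_eq_star_dotProduct] at this
      exact this
    rw [htr, ← Complex.ofReal_sum, Complex.ofReal_re]
    simp

end Nuclear

/-! ### Partial transposition -/

section PartialTranspose

variable {A A' B B' : Type}

theorem partialTranspose_sum {κ : Type} (s : Finset κ) (M : κ → Op A B) :
    partialTranspose (∑ k ∈ s, M k) = ∑ k ∈ s, partialTranspose (M k) := by
  ext x y
  simp [partialTranspose, Matrix.sum_apply]

theorem partialTranspose_smul (c : ℂ) (M : Op A B) :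
    partialTranspose (c • M) = c • partialTranspose M := by
  ext x y
  simp [partialTranspose]

theorem partialTranspose_zero : partialTranspose (0 : Op A B) = 0 := by
  ext x y
  simp [partialTranspose]

theorem partialTranspose_one [DecidableEq A] [DecidableEq B] :
    partialTranspose (1 : Op A B) = 1 := by
  ext ⟨a, b⟩ ⟨a', b'⟩
  simp only [partialTranspose, of_apply, one_apply, Prod.mk.injEq]
  grind

theorem partialTranspose_alice [Fintype A'] [Fintype B] [DecidableEq B] (K : Matrix A' A ℂ) (M : Op A' B) :
    partialTranspose ((K ⊗ₖ (1 : Matrix B B ℂ))ᴴ * M * (K ⊗ₖ (1 : Matrix B B ℂ))) =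
      (K ⊗ₖ (1 : Matrix B B ℂ))ᴴ * partialTranspose M * (K ⊗ₖ (1 : Matrix B B ℂ)) := by
  ext ⟨a, b⟩ ⟨a', b'⟩
  simp [partialTranspose, mul_apply, Fintype.sum_prod_type, kroneckerMap_apply, one_apply,
    Finset.sum_mul, apply_ite (starRingEnd ℂ)]

/-- Transposition on Bob's side reverses products, so `Kᴴ · K` turns into `Kᵀ · K̄`: the Kraus
operator is replaced by its entrywise conjugate. -/
theorem partialTranspose_bob [Fintype B'] [Fintype A] [DecidableEq A] (K : Matrix B' B ℂ) (M : Op A B') :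
    partialTranspose (((1 : Matrix A A ℂ) ⊗ₖ K)ᴴ * M * ((1 : Matrix A A ℂ) ⊗ₖ K)) =
      ((1 : Matrix A A ℂ) ⊗ₖ K.map star)ᴴ * partialTranspose M *
        ((1 : Matrix A A ℂ) ⊗ₖ K.map star) := by
  ext ⟨a, b⟩ ⟨a', b'⟩
  simp [partialTranspose, mul_apply, Fintype.sum_prod_type, kroneckerMap_apply, one_apply,
    Finset.sum_mul, apply_ite (starRingEnd ℂ)]
  rw [Finset.sum_comm]
  refine Finset.sum_congr rfl fun x _ => Finset.sum_congr rfl fun y _ => ?_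
  ring

variable [Fintype A] [Fintype B]

theorem trace_partialTranspose (M : Op A B) : (partialTranspose M).trace = M.trace := rfl

theorem trace_partialTranspose_mul (M N : Op A B) :
    (partialTranspose M * partialTranspose N).trace = (M * N).trace := by
  simp only [trace, diag_apply, mul_apply, partialTranspose, of_apply, Fintype.sum_prod_type]
  refine Finset.sum_congr rfl fun a _ => ?_
  rw [Finset.sum_comm]
  conv_rhs => rw [Finset.sum_comm]
  refine Finset.sum_congr rfl fun a' _ => ?_
  rw [Finset.sum_comm]

end PartialTranspose

/-! ### LOCC measurements have positive partial transposes -/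

theorem sum_sum_conjTranspose_mul_mul {ι ι' κ : Type} [Fintype ι'] [DecidableEq ι']
    [DecidableEq ι] [Fintype κ] {n : ℕ} {T : κ → Matrix ι' ι ℂ} (hT : ∑ k, (T k)ᴴ * T k = 1)
    {M : κ → Fin n → Matrix ι' ι' ℂ} (hM : ∀ k, ∑ i, M k i = 1) :
    ∑ i, ∑ k, (T k)ᴴ * M k i * T k = 1 := by
  rw [Finset.sum_comm, ← hT]
  refine Finset.sum_congr rfl fun k _ => ?_
  rw [← Matrix.sum_mul, ← Matrix.mul_sum, hM, Matrix.mul_one]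

theorem sum_conjTranspose_mul_kronecker_one {A A' B κ : Type} [Fintype A'] [Fintype B]
    [DecidableEq A] [DecidableEq B] [Fintype κ] {K : κ → Matrix A' A ℂ}
    (hK : ∑ k, (K k)ᴴ * K k = 1) :
    ∑ k, (K k ⊗ₖ (1 : Matrix B B ℂ))ᴴ * (K k ⊗ₖ (1 : Matrix B B ℂ)) = 1 := by
  simp_rw [conjTranspose_kronecker, ← mul_kronecker_mul, conjTranspose_one, Matrix.mul_one]
  rw [← one_kronecker_one, ← hK]
  ext x y
  simp [Matrix.sum_apply, kroneckerMap_apply, Finset.sum_mul]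

theorem sum_conjTranspose_mul_one_kronecker {A B B' κ : Type} [Fintype A] [Fintype B']
    [DecidableEq A] [DecidableEq B] [Fintype κ] {K : κ → Matrix B' B ℂ}
    (hK : ∑ k, (K k)ᴴ * K k = 1) :
    ∑ k, ((1 : Matrix A A ℂ) ⊗ₖ K k)ᴴ * ((1 : Matrix A A ℂ) ⊗ₖ K k) = 1 := by
  simp_rw [conjTranspose_kronecker, ← mul_kronecker_mul, conjTranspose_one, Matrix.mul_one]
  rw [← one_kronecker_one, ← hK]
  ext x y
  simp [Matrix.sum_apply, kroneckerMap_apply, Finset.mul_sum]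

/-- An LOCC measurement is a measurement whose effects have a positive partial transpose. -/
theorem isMeasurement_and_ppt_of_isLOCC {n : ℕ} {A B : Type} [Fintype A] [Fintype B]
    [DecidableEq A] [DecidableEq B] {M : Fin n → Op A B} (h : IsLOCC M) :
    IsMeasurement M ∧ ∀ i, (partialTranspose (M i)).PosSemidef := by
  induction h with
  | guess j =>
    refine ⟨⟨fun i => ?_, by simp⟩, fun i => ?_⟩
    · dsimp only
      split_ifs
      exacts [PosSemidef.one, PosSemidef.zero]
    · dsimp only
      split_ifs
      · rw [partialTranspose_one]
        exact PosSemidef.one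
      · rw [partialTranspose_zero]
        exact PosSemidef.zero
  | alice K hK M hM ih =>
    refine ⟨⟨fun i => posSemidef_sum _ fun k _ => ((ih k).1.1 i).conjTranspose_mul_mul_same _,
      sum_sum_conjTranspose_mul_mul (sum_conjTranspose_mul_kronecker_one hK) fun k => (ih k).1.2⟩,
      fun i => ?_⟩
    rw [partialTranspose_sum]
    refine posSemidef_sum _ fun k _ => ?_
    rw [partialTranspose_alice]
    exact ((ih k).2 i).conjTranspose_mul_mul_same _
  | bob K hK M hM ih =>
    refine ⟨⟨fun i => posSemidef_sum _ fun k _ => ((ih k).1.1 i).conjTranspose_mul_mul_same _,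
      sum_sum_conjTranspose_mul_mul (sum_conjTranspose_mul_one_kronecker hK) fun k => (ih k).1.2⟩,
      fun i => ?_⟩
    rw [partialTranspose_sum]
    refine posSemidef_sum _ fun k _ => ?_
    rw [partialTranspose_bob]
    exact ((ih k).2 i).conjTranspose_mul_mul_same _

/-! ### Tensor products with Alice's and Bob's factors grouped -/

section Tensor

variable {n : ℕ} {A B : Type} {L : ℕ}

theorem conjTranspose_tensorState (ρ : Fin n → Op A B) (c : Fin L → Fin n) :
    (tensorState ρ c)ᴴ = tensorState (fun i => (ρ i)ᴴ) c := by
  ext x y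
  simp [tensorState]

variable [Fintype A] [Fintype B]

/-- A pair of tuples is a tuple of pairs. This undoes the grouping by party, so that products,
traces and norms factor over the copies. -/
theorem sum_prod_pair (f : Fin L → A → B → ℂ) :
    ∑ x : (Fin L → A) × (Fin L → B), ∏ l, f l (x.1 l) (x.2 l) = ∏ l, ∑ z : A × B, f l z.1 z.2 := by
  classical
  rw [Finset.prod_univ_sum, Fintype.piFinset_univ]
  exact Fintype.sum_equiv (Equiv.arrowProdEquivProdArrow _ _ _).symm _ _ fun x => rfl

theorem tensorState_mul (ρ σ : Fin n → Op A B) (c : Fin L → Fin n) :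
    tensorState ρ c * tensorState σ c = tensorState (fun i => ρ i * σ i) c := by
  ext x y
  simp only [tensorState, mul_apply, of_apply, ← Finset.prod_mul_distrib]
  exact sum_prod_pair fun l a b => ρ (c l) (x.1 l, x.2 l) (a, b) * σ (c l) (a, b) (y.1 l, y.2 l)

theorem trace_tensorState (ρ : Fin n → Op A B) (c : Fin L → Fin n) :
    (tensorState ρ c).trace = ∏ l, (ρ (c l)).trace :=
  sum_prod_pair fun l a b => ρ (c l) (a, b) (a, b)

theorem isState_tensorState [DecidableEq A] [DecidableEq B] {ρ : Fin n → Op A B}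
    (hρ : ∀ i, IsState (ρ i)) (c : Fin L → Fin n) : IsState (tensorState ρ c) := by
  choose R hR using fun i => (hρ i).1.exists_conjTranspose_mul_self
  refine ⟨?_, by simp [trace_tensorState, (hρ _).2]⟩
  rw [funext hR, ← tensorState_mul, ← conjTranspose_tensorState]
  exact posSemidef_conjTranspose_mul_self _

/-- The nuclear norm is submultiplicative under tensor powers. -/
theorem NuclearLE.tensorState {X : Fin n → Op A B} {k : Fin n} {δ : ℝ} (h : NuclearLE (X k) δ) :
    NuclearLE (tensorState X fun _ : Fin L => k) (δ ^ L) := by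
  classical
  obtain ⟨J, _, u, v, hX, hδ⟩ := h
  let P : (J → EuclideanSpace ℂ (A × B)) → (Fin L → J) →
      EuclideanSpace ℂ ((Fin L → A) × (Fin L → B)) :=
    fun w f => WithLp.toLp 2 fun x => ∏ l, w (f l) (x.1 l, x.2 l)
  have hP : ∀ w f, ‖P w f‖ = ∏ l, ‖w (f l)‖ := by
    intro w f
    rw [← sq_eq_sq₀ (norm_nonneg _) (Finset.prod_nonneg fun _ _ => norm_nonneg _),
      ← Finset.prod_pow]
    simp_rw [EuclideanSpace.norm_sq_eq]
    have := sum_prod_pair fun l a b => (((‖w (f l) (a, b)‖ ^ 2 : ℝ)) : ℂ)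
    simp only [P, norm_prod, ← Finset.prod_pow]
    exact_mod_cast this
  refine ⟨Fin L → J, inferInstance, P u, P v, ?_, ?_⟩
  · ext x y
    simp only [QDH.tensorState, of_apply, hX, Matrix.sum_apply, vecMulVec_apply]
    rw [Finset.prod_univ_sum, Fintype.piFinset_univ]
    refine Finset.sum_congr rfl fun f _ => ?_
    simp [P, Finset.prod_mul_distrib]
  · simp_rw [hP, ← Finset.prod_mul_distrib]
    have h1 := Finset.prod_univ_sum (fun _ : Fin L => (Finset.univ : Finset J))
      (fun _ j => ‖u j‖ * ‖v j‖)
    rw [Fintype.piFinset_univ] at h1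
    rw [← h1, Finset.prod_const, Finset.card_univ, Fintype.card_fin]
    exact pow_le_pow_left₀ (Finset.sum_nonneg fun j _ => by positivity) hδ _

end Tensor

theorem ne_zero_of_isEnsemble {n : ℕ} {A B : Type} [Fintype A] [Fintype B] {η : Fin n → ℝ}
    {ρ : Fin n → Op A B} (hE : IsEnsemble η ρ) : n ≠ 0 := by
  rintro rfl
  simpa using hE.2.1

theorem isHermitian_partialTranspose {A B : Type} {ρ : Op A B} (hρ : ρ.IsHermitian) :
    (partialTranspose ρ).IsHermitian := by
  ext x y
  exact congrFun₂ hρ (x.1, y.2) (y.1, x.2)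

/-! ### Nuclear-norm bounds from `qG` -/

section OptimalValue

variable {n : ℕ} {A B : Type} [Fintype A] [Fintype B] [DecidableEq A] [DecidableEq B]

theorem avgSuccess_le_qG (η : Fin n → ℝ) (ρ : Fin n → Op A B) {M : Fin n → Op A B}
    (hM : IsMeasurement M) :
    avgSuccess η (fun i => partialTranspose (ρ i)) M ≤ qG η ρ := by
  refine le_csSup ?_ ⟨M, hM, rfl⟩
  -- The supremum is meaningful only for a set bounded above; any nuclear bounds for the transposed
  -- states provide this.
  choose δ hδ using fun i => exists_nuclearLE (partialTranspose (ρ i))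
  refine ⟨∑ i, |η i| * δ i, ?_⟩
  rintro _ ⟨N, hN, rfl⟩
  refine Finset.sum_le_sum fun i _ => ?_
  refine (le_abs_self _).trans ?_
  rw [abs_mul]
  refine mul_le_mul_of_nonneg_left ?_ (abs_nonneg _)
  refine (Complex.abs_re_le_norm _).trans ((hδ i).norm_trace_mul_le ?_)
  -- Indicator coefficients single out the effect `N i`.
  have h := norm_dotProduct_sum_smul_mulVec_le hN.1 hN.2
    (c := fun j => if j = i then 1 else 0) (fun j => by split_ifs <;> simp)
  simpa using h

/-- The measurement `(1 + Re (w i • C)) / n` of a form contraction `C`. -/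
theorem isMeasurement_one_add_re {w : Fin n → ℂ} (hn : n ≠ 0) (hw : ∀ i, ‖w i‖ ≤ 1)
    (hw0 : ∑ i, w i = 0) {C : Op A B}
    (hC : ∀ v : EuclideanSpace ℂ (A × B), ‖star v.ofLp ⬝ᵥ (C *ᵥ v.ofLp)‖ ≤ ‖v‖ ^ 2) :
    IsMeasurement fun i => (1 / (n : ℂ)) • (1 + (1 / 2 : ℂ) • (w i • C + (w i • C)ᴴ)) := by
  have hn' : (n : ℂ) ≠ 0 := by exact_mod_cast hn
  constructor
  · intro i
    refine PosSemidef.smul (PosSemidef.of_dotProduct_mulVec_nonneg ?_ fun v => ?_) ?_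
    · simp [IsHermitian, conjTranspose_smul, add_comm]
    · have h1 : star v ⬝ᵥ ((w i • C)ᴴ *ᵥ v) = star (star v ⬝ᵥ ((w i • C) *ᵥ v)) := by
        rw [dotProduct_mulVec, ← star_mulVec, star_dotProduct]
      have h2 : ‖star v ⬝ᵥ ((w i • C) *ᵥ v)‖ ≤ ‖WithLp.toLp 2 v‖ ^ 2 := by
        rw [smul_mulVec, dotProduct_smul, norm_smul]
        calc _ ≤ 1 * ‖star v ⬝ᵥ (C *ᵥ v)‖ := mul_le_mul_of_nonneg_right (hw i) (norm_nonneg _)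
          _ ≤ _ := by rw [one_mul]; exact hC (WithLp.toLp 2 v)
      have h3 := star_dotProduct_self (WithLp.toLp 2 v)
      simp only at h3
      rw [add_mulVec, dotProduct_add, one_mulVec, h3, smul_mulVec, dotProduct_smul, add_mulVec,
        dotProduct_add, h1]
      generalize star v ⬝ᵥ ((w i • C) *ᵥ v) = z at h2
      -- The form at `v` is `‖v‖² + Re z` with `|z| ≤ ‖v‖²`, hence nonnegative.
      have h4 : z + star z = ((2 * z.re : ℝ) : ℂ) := Complex.add_conj z
      have h5 : -‖z‖ ≤ z.re := (abs_le.mp (Complex.abs_re_le_norm z)).1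
      rw [h4, smul_eq_mul]
      have h6 : (0 : ℝ) ≤ ‖WithLp.toLp 2 v‖ ^ 2 + z.re := by linarith
      have h7 : (((‖WithLp.toLp 2 v‖ ^ 2 : ℝ) : ℂ) + 1 / 2 * ((2 * z.re : ℝ) : ℂ)) =
          ((‖WithLp.toLp 2 v‖ ^ 2 + z.re : ℝ) : ℂ) := by push_cast; ring
      rw [h7]
      exact_mod_cast h6
    · rw [one_div, ← Complex.ofReal_natCast, ← Complex.ofReal_inv]
      exact_mod_cast inv_nonneg.mpr (Nat.cast_nonneg n : (0 : ℝ) ≤ n)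
  · have h : ∑ i, (w i • C)ᴴ = 0 := by
      rw [← conjTranspose_sum, ← Finset.sum_smul, hw0, zero_smul, conjTranspose_zero]
    rw [← Finset.smul_sum, Finset.sum_add_distrib, ← Finset.smul_sum, Finset.sum_add_distrib, h,
      ← Finset.sum_smul, hw0, zero_smul, add_zero, smul_zero, add_zero, Finset.sum_const,
      Finset.card_univ, Fintype.card_fin, ← Nat.cast_smul_eq_nsmul ℂ, smul_smul,
      one_div_mul_cancel hn', one_smul]

theorem re_trace_mul_add_conjTranspose {H D : Op A B} (hH : H.IsHermitian) :
    (H * (1 + (1 / 2 : ℂ) • (D + Dᴴ))).trace.re = H.trace.re + (H * D).trace.re := by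
  have h : (H * Dᴴ).trace = star (H * D).trace := by
    rw [← trace_conjTranspose, conjTranspose_mul, hH.eq, trace_mul_comm]
  rw [mul_add, mul_one, mul_smul_comm, mul_add, trace_add, trace_smul, trace_add, h]
  simp
  ring

/-- The nuclear norm of a combination of the partially transposed states, with coefficients in the
unit disc that add up to zero, is bounded by the optimal value `qG`. -/
theorem nuclearLE_sum_smul_partialTranspose {η : Fin n → ℝ} {ρ : Fin n → Op A B}
    (hE : IsEnsemble η ρ) {w : Fin n → ℂ} (hw : ∀ i, ‖w i‖ ≤ 1) (hw0 : ∑ i, w i = 0) :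
    NuclearLE (∑ i, (w i * η i) • partialTranspose (ρ i)) (n * qG η ρ - 1) := by
  obtain ⟨C, hC, hX⟩ := exists_nuclearLE_trace_mul (∑ i, (w i * η i) • partialTranspose (ρ i))
  refine hX.mono ?_
  have hn := ne_zero_of_isEnsemble hE
  have hn0 : (n : ℝ) ≠ 0 := by exact_mod_cast hn
  -- With `X` the combination, this measurement has the value `(1 + Re Tr (X C)) / n`: the identity
  -- contributes `∑ η_i = 1`.
  have h := avgSuccess_le_qG η ρ (isMeasurement_one_add_re hn hw hw0 hC)
  have hval : ∀ i, (partialTranspose (ρ i) *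
      ((1 / (n : ℂ)) • (1 + (1 / 2 : ℂ) • (w i • C + (w i • C)ᴴ)))).trace.re =
      1 / n * (1 + (w i * (partialTranspose (ρ i) * C).trace).re) := by
    intro i
    have h1 := re_trace_mul_add_conjTranspose (D := w i • C)
      (isHermitian_partialTranspose (hE.2.2 i).1.1)
    rw [trace_partialTranspose, (hE.2.2 i).2, mul_smul_comm, trace_smul] at h1
    rw [mul_smul_comm, trace_smul, smul_eq_mul, show (1 / (n : ℂ)) = ((1 / n : ℝ) : ℂ) by push_cast; rfl,
      Complex.re_ofReal_mul, h1]
    simp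
  have h2 : avgSuccess η (fun i => partialTranspose (ρ i))
      (fun i => (1 / (n : ℂ)) • (1 + (1 / 2 : ℂ) • (w i • C + (w i • C)ᴴ))) =
      1 / n * (1 + ((∑ i, (w i * η i) • partialTranspose (ρ i)) * C).trace.re) := by
    simp only [avgSuccess, hval]
    rw [Matrix.sum_mul, trace_sum, Complex.re_sum]
    have h3 : ∀ i, (((w i * η i) • partialTranspose (ρ i)) * C).trace.re =
        η i * (w i * (partialTranspose (ρ i) * C).trace).re := by
      intro i
      rw [smul_mul_assoc, trace_smul, smul_eq_mul, ← Complex.re_ofReal_mul]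
      ring_nf
    simp_rw [h3]
    rw [← hE.2.1, ← Finset.sum_add_distrib, Finset.mul_sum]
    exact Finset.sum_congr rfl fun i _ => by rw [hE.2.1]; ring
  rw [h2, one_div, inv_mul_le_iff₀ (by positivity)] at h
  linarith

end OptimalValue

/-! ### The folded ensemble as an inverse Fourier transform -/

section Fold

variable {n : ℕ} {A B : Type} {L : ℕ}

/-- The arbitrary state `τ i` drops out: if the class has probability zero, nonnegativity forces
each of its weights to vanish, so both sides are zero. -/
theorem foldProb_smul_foldState {η : Fin n → ℝ} (hη : ∀ i, 0 ≤ η i) (ρ : Fin n → Op A B)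
    (τ : Fin n → Op (Fin L → A) (Fin L → B)) (i : Fin n) :
    ((foldProb η L i : ℝ) : ℂ) • foldState η ρ L τ i =
      ∑ c ∈ sumClass L i, ((∏ l, η (c l) : ℝ) : ℂ) • tensorState ρ c := by
  unfold foldState
  split_ifs with h
  · rw [h, Complex.ofReal_zero, zero_smul]
    rw [foldProb, Finset.sum_eq_zero_iff_of_nonneg
      fun c _ => Finset.prod_nonneg fun l _ => hη _] at h
    rw [Finset.sum_eq_zero fun c hc => by rw [h c hc, Complex.ofReal_zero, zero_smul]]
  · rw [smul_smul, ← Complex.ofReal_mul, mul_one_div_cancel h, Complex.ofReal_one, one_smul]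

theorem sum_foldProb (hn : n ≠ 0) (η : Fin n → ℝ) (L : ℕ) :
    ∑ i, foldProb η L i = (∑ i, η i) ^ L := by
  have h1 := Finset.prod_univ_sum (fun _ : Fin L => (Finset.univ : Finset (Fin n))) (fun _ j => η j)
  rw [Fintype.piFinset_univ, Finset.prod_const, Finset.card_univ, Fintype.card_fin] at h1
  simp only [h1, foldProb, sumClass, Finset.sum_filter]
  rw [Finset.sum_comm]
  refine Finset.sum_congr rfl fun c _ => ?_
  rw [Finset.sum_eq_single ⟨(∑ l, (c l : ℕ)) % n, Nat.mod_lt _ (Nat.pos_of_ne_zero hn)⟩]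
  · simp
  · intro i _ hi
    rw [if_neg fun h => hi (Fin.ext h.symm)]
  · simp

variable [Fintype A] [Fintype B]

theorem isState_foldState [DecidableEq A] [DecidableEq B] {η : Fin n → ℝ} {ρ : Fin n → Op A B}
    (hE : IsEnsemble η ρ) {τ : Fin n → Op (Fin L → A) (Fin L → B)} (hτ : ∀ i, IsState (τ i))
    (i : Fin n) : IsState (foldState η ρ L τ i) := by
  unfold foldState
  split_ifs with h
  · exact hτ i
  · have hp : ∀ c : Fin L → Fin n, 0 ≤ ∏ l, η (c l) := fun c => Finset.prod_nonneg fun l _ => hE.1 _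
    have h0 : 0 ≤ foldProb η L i := Finset.sum_nonneg fun c _ => hp c
    constructor
    · refine PosSemidef.smul (posSemidef_sum _ fun c _ =>
        PosSemidef.smul (isState_tensorState hE.2.2 c).1 ?_) ?_
      · exact_mod_cast hp c
      · exact_mod_cast one_div_nonneg.mpr h0
    · rw [trace_smul, trace_sum]
      simp_rw [trace_smul, (isState_tensorState hE.2.2 _).2, smul_eq_mul, mul_one]
      rw [← Complex.ofReal_sum, ← Complex.ofReal_mul]
      change ((1 / foldProb η L i * foldProb η L i : ℝ) : ℂ) = 1
      rw [one_div_mul_cancel h, Complex.ofReal_one]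

/-- The discrete Fourier transform of the partially transposed ensemble. -/
noncomputable def fourierOp (ζ : ℂ) (η : Fin n → ℝ) (ρ : Fin n → Op A B) (k : Fin n) : Op A B :=
  ∑ i : Fin n, (ζ ^ ((k : ℕ) * (i : ℕ)) * η i) • partialTranspose (ρ i)

-- Expanding the tensor power, the phases of the factors multiply and their exponents add up, so the
-- phase of `c` depends only on the sum of its entries.
omit [Fintype A] [Fintype B] in
theorem tensorState_fourierOp (ζ : ℂ) (η : Fin n → ℝ) (ρ : Fin n → Op A B) (k : Fin n) :
    tensorState (fourierOp ζ η ρ) (fun _ : Fin L => k) =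
      ∑ c : Fin L → Fin n, (ζ ^ ((k : ℕ) * ∑ l, (c l : ℕ)) * ((∏ l, η (c l) : ℝ) : ℂ)) •
        partialTranspose (tensorState ρ c) := by
  ext x y
  simp only [tensorState, fourierOp, partialTranspose, of_apply, Matrix.sum_apply, Matrix.smul_apply]
  rw [Finset.prod_univ_sum, Fintype.piFinset_univ]
  refine Finset.sum_congr rfl fun c _ => ?_
  simp only [smul_eq_mul, Finset.prod_mul_distrib, Finset.mul_sum, Finset.prod_pow_eq_pow_sum]
  push_cast
  rfl

theorem sum_pow_mul_of_isPrimitiveRoot {ζ : ℂ} (hζ : IsPrimitiveRoot ζ n) (m : ℕ) :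
    ∑ k : Fin n, ζ ^ (k * m : ℕ) = if n ∣ m then (n : ℂ) else 0 := by
  rw [Fin.sum_univ_eq_sum_range fun k => ζ ^ (k * m)]
  simp_rw [mul_comm _ m, pow_mul]
  split_ifs with h
  · rw [(hζ.pow_eq_one_iff_dvd m).mpr h]
    simp
  · have h1 := mul_neg_geom_sum (ζ ^ m) n
    rw [← pow_mul, mul_comm m n, pow_mul, hζ.pow_eq_one, one_pow, sub_self] at h1
    refine (mul_eq_zero.mp h1).resolve_left fun h2 => h ((hζ.pow_eq_one_iff_dvd m).mp ?_)
    exact (sub_eq_zero.mp h2).symm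

/-- In natural-number exponents `n - i` plays the role of `-i`. -/
theorem dvd_sub_add_iff (i : Fin n) (s : ℕ) : n ∣ (n - i) + s ↔ s % n = i := by
  have h1 : (n - i) + (i : ℕ) ≡ 0 [MOD n] := by
    rw [Nat.sub_add_cancel i.2.le]
    exact (Nat.modEq_zero_iff_dvd).mpr dvd_rfl
  rw [← Nat.modEq_zero_iff_dvd]
  have h2 : s % n = i ↔ s ≡ i [MOD n] := by rw [Nat.ModEq, Nat.mod_eq_of_lt i.2]
  rw [h2]
  exact ⟨fun h => Nat.ModEq.add_left_cancel' _ (h.trans h1.symm), fun h => (h.add_left _).trans h1⟩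

-- Fourier inversion: averaging `ζ^(k (∑ c_l - i))` over `k` gives the indicator of the class of
-- `i`.
omit [Fintype A] [Fintype B] in
theorem foldProb_smul_partialTranspose_foldState {ζ : ℂ} (hζ : IsPrimitiveRoot ζ n) (hn : n ≠ 0)
    {η : Fin n → ℝ} (hη : ∀ i, 0 ≤ η i) (ρ : Fin n → Op A B)
    (τ : Fin n → Op (Fin L → A) (Fin L → B)) (i : Fin n) :
    ((foldProb η L i : ℝ) : ℂ) • partialTranspose (foldState η ρ L τ i) =
      (1 / n : ℂ) • ∑ k : Fin n, ζ ^ (k * (n - i) : ℕ) •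
        tensorState (fourierOp ζ η ρ) (fun _ : Fin L => k) := by
  have hn' : (n : ℂ) ≠ 0 := by exact_mod_cast hn
  rw [← partialTranspose_smul, foldProb_smul_foldState hη, partialTranspose_sum, sumClass,
    Finset.sum_filter]
  simp_rw [tensorState_fourierOp, Finset.smul_sum]
  rw [Finset.sum_comm]
  refine Finset.sum_congr rfl fun c _ => ?_
  simp_rw [smul_smul, ← Finset.sum_smul]
  have h : ∀ k : Fin n, (1 / n : ℂ) * (ζ ^ (k * (n - i) : ℕ) *
      (ζ ^ ((k : ℕ) * ∑ l, (c l : ℕ)) * ((∏ l, η (c l) : ℝ) : ℂ))) =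
      (1 / n : ℂ) * ((∏ l, η (c l) : ℝ) : ℂ) * ζ ^ (k * ((n - i) + ∑ l, (c l : ℕ)) : ℕ) := by
    intro k
    rw [mul_add, pow_add]
    ring
  simp_rw [h]
  rw [← Finset.mul_sum, sum_pow_mul_of_isPrimitiveRoot hζ]
  simp_rw [dvd_sub_add_iff]
  split_ifs
  · rw [partialTranspose_smul, mul_comm, ← mul_assoc, mul_one_div_cancel hn', one_mul]
  · rw [mul_zero, zero_smul]

end Fold

/-! ### Success probabilities of LOCC measurements -/

section Bounds

variable {n : ℕ} {A B : Type} [Fintype A] [Fintype B] [DecidableEq A] [DecidableEq B]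

theorem re_trace_mul_nonneg {ι : Type} [Fintype ι] [DecidableEq ι] {ρ M : Matrix ι ι ℂ}
    (hρ : ρ.PosSemidef) (hM : M.PosSemidef) : 0 ≤ (ρ * M).trace.re := by
  obtain ⟨R, rfl⟩ := hM.exists_conjTranspose_mul_self
  rw [← Matrix.mul_assoc, trace_mul_comm, ← Matrix.mul_assoc]
  exact (Complex.le_def.mp (hρ.mul_mul_conjTranspose_same R).trace_nonneg).1

theorem re_trace_mul_le_one {σ : Op A B} (hσ : IsState σ) {M : Fin n → Op A B}
    (hM : IsMeasurement M) (i : Fin n) : (σ * M i).trace.re ≤ 1 := by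
  have h : ∑ j, (σ * M j).trace.re = 1 := by
    rw [← Complex.re_sum, ← trace_sum, ← Matrix.mul_sum, hM.2, Matrix.mul_one, hσ.2,
      Complex.one_re]
  rw [← h]
  exact Finset.single_le_sum (f := fun j => (σ * M j).trace.re)
    (fun j _ => re_trace_mul_nonneg hσ.1 (hM.1 j)) (Finset.mem_univ i)

theorem norm_average_sub_le {t : Fin n → ℂ} {k₀ : Fin n} {ε : ℝ} (h1 : t k₀ = 1)
    (ht : ∀ k, k ≠ k₀ → ‖t k‖ ≤ ε) : ‖(1 / n : ℂ) * ∑ k, t k - 1 / n‖ ≤ (n - 1) / n * ε := by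
  have hn : 1 ≤ n := k₀.pos
  rw [← Finset.add_sum_erase _ _ (Finset.mem_univ k₀), h1, mul_add, mul_one, add_sub_cancel_left,
    norm_mul]
  have h2 : ‖∑ k ∈ Finset.univ.erase k₀, t k‖ ≤ (n - 1) * ε := by
    refine (norm_sum_le_of_le _ fun k hk => ht k (Finset.ne_of_mem_erase hk)).trans (le_of_eq ?_)
    rw [Finset.sum_const, Finset.card_erase_of_mem (Finset.mem_univ _), Finset.card_univ,
      Fintype.card_fin, nsmul_eq_mul, Nat.cast_sub hn, Nat.cast_one]
  rw [norm_div, norm_one, Complex.norm_natCast]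
  calc _ ≤ 1 / (n : ℝ) * ((n - 1) * ε) := mul_le_mul_of_nonneg_left h2 (by positivity)
    _ = _ := by ring

theorem norm_star_dotProduct_le {ι : Type} [Fintype ι] (u v : EuclideanSpace ℂ ι) :
    ‖star v.ofLp ⬝ᵥ u.ofLp‖ ≤ ‖v‖ * ‖u‖ := by
  rw [dotProduct_comm, ← EuclideanSpace.inner_eq_star_dotProduct]
  exact norm_inner_le_norm v u

/-- Replacing a probability vector `p` by the uniform one changes the average of the numbers
`t i ∈ [0, 1]` by at most the total variation distance. -/
theorem sum_uniform_mul_le {p t : Fin n → ℝ} {ε : ℝ} (hn : n ≠ 0) (hp : ∑ i, p i = 1)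
    (hpε : ∀ i, |p i - 1 / n| ≤ ε) (ht0 : ∀ i, 0 ≤ t i) (ht1 : ∀ i, t i ≤ 1) :
    ∑ i, 1 / (n : ℝ) * t i ≤ ∑ i, p i * t i + n * ε / 2 := by
  have hn0 : (n : ℝ) ≠ 0 := by exact_mod_cast hn
  -- The excess `(1/n - p i) * t i` is at most the positive part of `x = 1/n - p i`, which is `(|x|
  -- + x) / 2`. The summands `x / 2` cancel in total.
  have h : ∀ i, 1 / (n : ℝ) * t i ≤ p i * t i + (ε + (1 / n - p i)) / 2 := by
    intro i
    have h1 := abs_le.mp (hpε i)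
    rcases le_total (p i) (1 / n) with h2 | h2
    · nlinarith [ht0 i, ht1 i]
    · nlinarith [ht0 i, ht1 i]
  refine (Finset.sum_le_sum fun i _ => h i).trans (le_of_eq ?_)
  rw [Finset.sum_add_distrib, ← Finset.sum_div, Finset.sum_add_distrib, Finset.sum_sub_distrib, hp]
  simp [mul_inv_cancel₀ hn0]

variable {η : Fin n → ℝ} {ρ : Fin n → Op A B}

/-- Zero coefficients are allowed in the nuclear bound, and a nuclear bound is never negative. -/
theorem sub_one_nonneg_of_isEnsemble (hE : IsEnsemble η ρ) : 0 ≤ n * qG η ρ - 1 :=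
  (nuclearLE_sum_smul_partialTranspose hE (w := 0) (by simp) (by simp)).nonneg

/-- For `0 < k < n` the character `i ↦ ζ^(k i)` is nontrivial, so its values add up to zero. -/
theorem nuclearLE_fourierOp {ζ : ℂ} (hζ : IsPrimitiveRoot ζ n) (hE : IsEnsemble η ρ) {k : Fin n}
    (hk : (k : ℕ) ≠ 0) : NuclearLE (fourierOp ζ η ρ k) (n * qG η ρ - 1) := by
  refine nuclearLE_sum_smul_partialTranspose hE (fun i => ?_) ?_
  · rw [norm_pow, hζ.norm'_eq_one (ne_zero_of_isEnsemble hE), one_pow]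
  · simp_rw [mul_comm (k : ℕ)]
    rw [sum_pow_mul_of_isPrimitiveRoot hζ,
      if_neg fun h => absurd (Nat.le_of_dvd (Nat.pos_of_ne_zero hk) h) (not_le.mpr k.2)]

omit [DecidableEq A] [DecidableEq B] in
theorem trace_fourierOp_zero (ζ : ℂ) (hE : IsEnsemble η ρ) {k : Fin n} (hk : (k : ℕ) = 0) :
    (fourierOp ζ η ρ k).trace = 1 := by
  simp only [fourierOp, hk, trace_sum, trace_smul, trace_partialTranspose, (hE.2.2 _).2, zero_mul,
    pow_zero, one_mul, smul_eq_mul, mul_one]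
  exact_mod_cast hE.2.1

variable {L : ℕ} {τ : Fin n → Op (Fin L → A) (Fin L → B)}

/-- The trace of the inversion formula: `Tr X_0 = 1`, and for `k ≠ 0` the trace is a pairing with
the contraction `1`, bounded by the nuclear norm. -/
theorem abs_foldProb_sub_le (hE : IsEnsemble η ρ) (hτ : ∀ i, IsState (τ i)) (i : Fin n) :
    |foldProb η L i - 1 / n| ≤ (n - 1) / n * (n * qG η ρ - 1) ^ L := by
  have hn := ne_zero_of_isEnsemble hE
  have hζ := Complex.isPrimitiveRoot_exp n hn
  set ζ := Complex.exp (2 * Real.pi * Complex.I / n)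
  have h := congrArg trace (foldProb_smul_partialTranspose_foldState (L := L) hζ hn hE.1 ρ τ i)
  rw [trace_smul, trace_partialTranspose, (isState_foldState hE hτ i).2, trace_smul, trace_sum,
    smul_eq_mul, smul_eq_mul, mul_one] at h
  have h2 := norm_average_sub_le (k₀ := ⟨0, Nat.pos_of_ne_zero hn⟩)
    (t := fun k : Fin n => (ζ ^ ((k : ℕ) * (n - i) : ℕ) •
      tensorState (fourierOp ζ η ρ) (fun _ : Fin L => k)).trace) (ε := (n * qG η ρ - 1) ^ L)
    (by simp [trace_tensorState, trace_fourierOp_zero ζ hE (k := ⟨0, Nat.pos_of_ne_zero hn⟩) rfl])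
    (by
      intro k hk
      have hk' : (k : ℕ) ≠ 0 := fun h => hk (Fin.ext h)
      rw [trace_smul, norm_smul, norm_pow, hζ.norm'_eq_one hn, one_pow, one_mul]
      have h3 := ((nuclearLE_fourierOp hζ hE hk').tensorState (L := L)).norm_trace_mul_le (C := 1)
        fun u v => by rw [one_mulVec]; exact norm_star_dotProduct_le u v
      rwa [Matrix.mul_one] at h3)
  rw [← h] at h2
  rw [← Real.norm_eq_abs, ← Complex.norm_real]
  push_cast
  exact h2

/-- Partial transposition preserves the trace pairing, so it can be moved onto both states and
effects. The operator then paired with `X_k^{⊗L}` is a combination of the effects `N i` with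
unimodular coefficients, hence a contraction; for `k = 0` it is the identity. -/
theorem sum_foldProb_mul_le (hE : IsEnsemble η ρ) {M : Fin n → Op (Fin L → A) (Fin L → B)}
    (hM : IsLOCC M) :
    ∑ i, foldProb η L i * (foldState η ρ L τ i * M i).trace.re ≤
      1 / n + (n - 1) / n * (n * qG η ρ - 1) ^ L := by
  have hn := ne_zero_of_isEnsemble hE
  have hζ := Complex.isPrimitiveRoot_exp n hn
  set ζ := Complex.exp (2 * Real.pi * Complex.I / n)
  obtain ⟨⟨-, hM1⟩, hN⟩ := isMeasurement_and_ppt_of_isLOCC hM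
  set N : Fin n → Op (Fin L → A) (Fin L → B) := fun i => partialTranspose (M i) with hNdef
  have hN1 : ∑ i, N i = 1 := by rw [hNdef, ← partialTranspose_sum, hM1, partialTranspose_one]
  let t : Fin n → ℂ := fun k => (tensorState (fourierOp ζ η ρ) (fun _ : Fin L => k) *
    ∑ i : Fin n, ζ ^ ((k : ℕ) * (n - i) : ℕ) • N i).trace
  have h : ∑ i, ((foldProb η L i : ℝ) : ℂ) * (foldState η ρ L τ i * M i).trace =
      (1 / n : ℂ) * ∑ k, t k := by
    have h1 : ∀ i, ((foldProb η L i : ℝ) : ℂ) * (foldState η ρ L τ i * M i).trace =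
        (1 / n : ℂ) * ∑ k : Fin n, ζ ^ ((k : ℕ) * (n - i) : ℕ) *
          (tensorState (fourierOp ζ η ρ) (fun _ : Fin L => k) * N i).trace := by
      intro i
      rw [← trace_partialTranspose_mul, ← smul_eq_mul, ← trace_smul, ← smul_mul_assoc,
        foldProb_smul_partialTranspose_foldState hζ hn hE.1, smul_mul_assoc, trace_smul,
        smul_eq_mul, Matrix.sum_mul, trace_sum]
      simp_rw [smul_mul_assoc, trace_smul, smul_eq_mul]
      rfl
    simp_rw [h1, t, Matrix.mul_sum, trace_sum, mul_smul_comm, trace_smul, smul_eq_mul]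
    rw [← Finset.mul_sum, Finset.sum_comm]
  have h2 := norm_average_sub_le (k₀ := ⟨0, Nat.pos_of_ne_zero hn⟩) (t := t)
    (ε := (n * qG η ρ - 1) ^ L)
    (by
      simp only [t, zero_mul, pow_zero, one_smul, hN1, Matrix.mul_one, trace_tensorState]
      simp [trace_fourierOp_zero ζ hE (k := ⟨0, Nat.pos_of_ne_zero hn⟩) rfl])
    (by
      intro k hk
      have hk' : (k : ℕ) ≠ 0 := fun h => hk (Fin.ext h)
      refine ((nuclearLE_fourierOp hζ hE hk').tensorState (L := L)).norm_trace_mul_le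
        (norm_dotProduct_sum_smul_mulVec_le hN hN1 fun i => ?_)
      rw [norm_pow, hζ.norm'_eq_one hn, one_pow])
  rw [← h] at h2
  have h3 := (Complex.re_le_norm _).trans h2
  rw [Complex.sub_re, Complex.re_sum] at h3
  simp_rw [Complex.re_ofReal_mul] at h3
  have h4 : (1 / (n : ℂ)).re = 1 / n := by
    rw [show (1 / (n : ℂ)) = ((1 / n : ℝ) : ℂ) by push_cast; rfl, Complex.ofReal_re]
  rw [h4] at h3
  linarith

/-- The argument yields the coefficient `(n - 1)(n + 2) / (2n)`. The stated one exceeds it by `(n -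
1)(n - 2) / 2`, which vanishes for `n = 1` and `n = 2`. -/
theorem uniform_bound_coeff_le (hn : n ≠ 0) {ε : ℝ} (hε : 0 ≤ ε) :
    1 / (n : ℝ) + (n - 1) / n * ε + n * ((n - 1) / n * ε) / 2 ≤
      1 / n + ((n : ℝ) - 1) * ((n : ℝ) ^ 2 - n + 2) / (2 * n) * ε := by
  have hn1 : (1 : ℝ) ≤ n := by exact_mod_cast Nat.one_le_iff_ne_zero.mpr hn
  have h0 : (0 : ℝ) ≤ (n - 1) * (n - 2) := by
    rcases Nat.lt_or_ge n 2 with h | h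
    · have : n = 1 := by omega
      subst this
      norm_num
    · have : (2 : ℝ) ≤ n := by exact_mod_cast h
      exact mul_nonneg (by linarith) (by linarith)
  have h : 1 / (n : ℝ) + ((n : ℝ) - 1) * ((n : ℝ) ^ 2 - n + 2) / (2 * n) * ε -
      (1 / (n : ℝ) + (n - 1) / n * ε + n * ((n - 1) / n * ε) / 2) = (n - 1) * (n - 2) * ε / 2 := by
    field_simp
    ring
  have := mul_nonneg h0 hε
  linarith

theorem avgSuccess_foldState_le (hE : IsEnsemble η ρ) (hτ : ∀ i, IsState (τ i))
    {M : Fin n → Op (Fin L → A) (Fin L → B)} (hM : IsLOCC M) :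
    avgSuccess (fun _ => 1 / (n : ℝ)) (foldState η ρ L τ) M ≤
      1 / (n : ℝ) + (((n : ℝ) - 1) * ((n : ℝ) ^ 2 - (n : ℝ) + 2) / (2 * (n : ℝ))) *
        ((n : ℝ) * qG η ρ - 1) ^ L := by
  have hn := ne_zero_of_isEnsemble hE
  have hmeas := (isMeasurement_and_ppt_of_isLOCC hM).1
  refine (sum_uniform_mul_le hn (by rw [sum_foldProb hn, hE.2.1, one_pow])
    (fun i => abs_foldProb_sub_le hE hτ i)
    (fun i => re_trace_mul_nonneg (isState_foldState hE hτ i).1 (hmeas.1 i))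
    (fun i => re_trace_mul_le_one (isState_foldState hE hτ i) hmeas i)).trans ?_
  -- One error comes from discrimination with the priors `η_i^(L)`, the other from replacing them by
  -- uniform priors.
  refine le_trans (add_le_add_left (sum_foldProb_mul_le hE hM) _) ?_
  exact uniform_bound_coeff_le hn (pow_nonneg (sub_one_nonneg_of_isEnsemble hE) L)

theorem pL_foldState_le (hE : IsEnsemble η ρ) (hτ : ∀ i, IsState (τ i)) :
    pL (fun _ : Fin n => 1 / (n : ℝ)) (foldState η ρ L τ) ≤
      1 / (n : ℝ) + (((n : ℝ) - 1) * ((n : ℝ) ^ 2 - (n : ℝ) + 2) / (2 * (n : ℝ))) *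
        ((n : ℝ) * qG η ρ - 1) ^ L := by
  refine csSup_le ⟨_, _, IsLOCC.guess ⟨0, Nat.pos_of_ne_zero (ne_zero_of_isEnsemble hE)⟩, rfl⟩ ?_
  rintro _ ⟨M, hM, rfl⟩
  exact avgSuccess_foldState_le hE hτ hM

theorem le_pL_foldState (hE : IsEnsemble η ρ) (hτ : ∀ i, IsState (τ i)) :
    1 / (n : ℝ) ≤ pL (fun _ : Fin n => 1 / (n : ℝ)) (foldState η ρ L τ) := by
  let j : Fin n := ⟨0, Nat.pos_of_ne_zero (ne_zero_of_isEnsemble hE)⟩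
  -- The upper bound just proved shows that the set is bounded; the constant guess `j` attains
  -- `1/n`.
  refine le_csSup ⟨1 / (n : ℝ) + (((n : ℝ) - 1) * ((n : ℝ) ^ 2 - (n : ℝ) + 2) / (2 * (n : ℝ))) *
    ((n : ℝ) * qG η ρ - 1) ^ L, ?_⟩ ⟨_, IsLOCC.guess j, ?_⟩
  · rintro _ ⟨M, hM, rfl⟩
    exact avgSuccess_foldState_le hE hτ hM
  · rw [avgSuccess, Finset.sum_eq_single j]
    · simp [(isState_foldState hE hτ j).2]
    · intro i _ hi
      simp [hi]
    · simp

end Bounds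

end

theorem theorem5 {n dA dB : ℕ}
    (η : Fin n → ℝ) (ρ : Fin n → Op (Fin dA) (Fin dB)) (hE : IsEnsemble η ρ)
    (τ : (L : ℕ) → Fin n → Op (Fin L → Fin dA) (Fin L → Fin dB))
    (hτ : ∀ L i, IsState (τ L i)) :
    (∀ L : ℕ, 1 ≤ L →
      pL (fun _ : Fin n => 1 / (n : ℝ)) (foldState η ρ L (τ L)) ≤
        1 / (n : ℝ) + (((n : ℝ) - 1) * ((n : ℝ) ^ 2 - (n : ℝ) + 2) / (2 * (n : ℝ))) *
          ((n : ℝ) * qG η ρ - 1) ^ L) ∧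
    (qG η ρ < 2 / (n : ℝ) →
      Filter.Tendsto
        (fun L : ℕ => pL (fun _ : Fin n => 1 / (n : ℝ)) (foldState η ρ L (τ L)))
        Filter.atTop (nhds (1 / (n : ℝ)))) := by
  refine ⟨fun L _ => pL_foldState_le hE (hτ L), fun hq => ?_⟩
  have hn := ne_zero_of_isEnsemble hE
  have hn0 : (0 : ℝ) < n := by exact_mod_cast Nat.pos_of_ne_zero hn
  have h1 : (n : ℝ) * qG η ρ - 1 < 1 := by
    rw [lt_div_iff₀ hn0] at hq
    linarith
  refine tendsto_of_tendsto_of_tendsto_of_le_of_le tendsto_const_nhds ?_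
    (fun L => le_pL_foldState hE (hτ L)) (fun L => pL_foldState_le hE (hτ L))
  simpa using ((tendsto_pow_atTop_nhds_zero_of_lt_one (sub_one_nonneg_of_isEnsemble hE) h1).const_mul
    (((n : ℝ) - 1) * ((n : ℝ) ^ 2 - (n : ℝ) + 2) / (2 * (n : ℝ)))).const_add (1 / (n : ℝ))
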